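/- **Theorem (Kozlov).** Let $d\ge 1$, $U=\{e\in\mathbb Z^d:|e|_1=1\}$, $\mathcal P=\{(p(e))_{e\in U}\in[0,1]^U:\sum_{e\in U}p(e)=1\}$, and let $\Omega=\mathcal P^{\mathbb Z^d}$ be the space of environments $\omega=(\omega(x,e))_{x\in\mathbb Z^d,\,e\in U}$, with the product topology and its Borel $\sigma$-algebra. For $y\in\mathbb Z^d$ let $t_y:\Omega\to\Omega$, $(t_y\omega)(x,e)=\omega(x+y,e)$. For $\omega\in\Omega$ let $P_{0,\omega}$ be the law of the Markov chain $(X_n)_{n\ge0}$ on $\mathbb Z^d$ with $X_0=0$ that jumps from $y$ to $y+e$ with probability $\omega(y,e)$, $e\in U$. The environment viewed from the particle is $\bar\omega_n=t_{X_n}\omega$, $n\ge 0$; let $P_\omega$ be the law of $(\bar\omega_n)_{n\ge0}$ on $\Omega^{\mathbb N}$ under $P_{0,\omega}$, and for a probability measure $\nu$ on $\Omega$ put $P_\nu=\int P_\omega\,\nu(d\omega)$. The process $(\bar\omega_n)$ has the transition kernel $Rf(\omega)=\sum_{e\in U}\omega(0,e)f(t_e\omega)$; for a probability measure $\mu$ on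 $\Omega$ the probability measure $\mu R$ is defined by $\int f\,d(\mu R)=\int Rf\,d\mu$ for all bounded continuous $f$, and $\mu$ is called invariant if $\mu R=\mu$. Let $\mathbb P$ be a probability measure on $\Omega$ that is elliptic, that is, $\mathbb P[\min_{e\in U}\omega(x,e)>0]=1$ for every $x\in\mathbb Z^d$, and totally ergodic, that is, $\mathbb P(A)\in\{0,1\}$ for every Borel set $A\subseteq\Omega$ with $t_x^{-1}(A)=A$ for all $x\in\mathbb Z^d$. Suppose that $\nu$ is an invariant probability measure that is absolutely continuous with respect to $\mathbb P$. Then: 1. $\nu$ and $\mathbb P$ are equivalent, that is, mutually absolutely continuous. 2. The environment viewed from the particle with initial law $\nu$ is ergodic: the shift $\theta(\omega_0,\omega_1,\dots)=(\omega_1,\omega_2,\dots)$ on $\Omega^{\mathbb N}$ preserves $P_\nu$, and $P_\nu(A)\in\{0,1\}$ for every Borel set $A\subseteq\Omega^{\mathbb N}$ with $\theta^{-1}(A)=A$. 3. $\nu$ is the only invariant probability measure that is absolutely continuous with respect to $\mathbb P$. 4. The Cesàro means $\frac1{n+1}\sum_{i=0}^n\mathbb P R^i$ converge weakly to $\nu$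 as $n\to\infty$. -/

import Mathlib

open MeasureTheory ProbabilityTheory Filter Topology

noncomputable section

namespace RWRE

/-- The set `U` of unit jumps: the points of `ℤ^d` with `ℓ¹`-norm `1`. -/
abbrev Jump (d : ℕ) : Type := {e : Fin d → ℤ // ∑ i, |e i| = 1}

theorem finite_jump (d : ℕ) : Finite (Jump d) := by
  have h : ({e : Fin d → ℤ | ∑ i, |e i| = 1}).Finite := by
    refine (Set.finite_Icc (fun _ : Fin d => (-1 : ℤ)) (fun _ => 1)).subset ?_
    intro e he
    have key : ∀ i, |e i| ≤ 1 := fun i => by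
      rw [← (he : ∑ i, |e i| = 1)]
      exact Finset.single_le_sum (f := fun i => |e i|) (fun j _ => abs_nonneg _)
        (Finset.mem_univ i)
    exact ⟨fun i => (abs_le.1 (key i)).1, fun i => (abs_le.1 (key i)).2⟩
  exact h

instance (d : ℕ) : Fintype (Jump d) :=
  @Fintype.ofFinite _ (finite_jump d)

/-- The environment space `Ω = 𝒫 ^ (ℤ^d)`, where `𝒫` is the set of probability vectors indexed
by the unit jumps. It carries the product topology and the product σ-algebra, which is the Borel
σ-algebra. -/
abbrev Env (d : ℕ) : Type := (Fin d → ℤ) → stdSimplex ℝ (Jump d)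

theorem borelSpace_env (d : ℕ) : BorelSpace (Env d) := inferInstance

/-- The translation `t_y`, given by `(t_y ω)(x, e) = ω(x + y, e)`. -/
def translate {d : ℕ} (y : Fin d → ℤ) (ω : Env d) : Env d := fun x => ω (x + y)

theorem measurable_translate {d : ℕ} (y : Fin d → ℤ) : Measurable (translate y : Env d → Env d) :=
  measurable_pi_lambda _ fun x => measurable_pi_apply (x + y)

theorem measurable_prob {d : ℕ} (x : Fin d → ℤ) (e : Jump d) :
    Measurable fun ω : Env d => ENNReal.ofReal (ω x e) := by
  have h : Measurable fun ω : Env d => (ω x).1 e :=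
    (measurable_pi_apply e).comp (measurable_subtype_coe.comp (measurable_pi_apply x))
  exact h.ennreal_ofReal

theorem sum_prob {d : ℕ} (ω : Env d) (x : Fin d → ℤ) :
    ∑ e : Jump d, ENNReal.ofReal (ω x e) = 1 := by
  rw [← ENNReal.ofReal_sum_of_nonneg fun e _ => stdSimplex.zero_le (ω x) e,
    stdSimplex.sum_eq_one, ENNReal.ofReal_one]

/-! ### The random walk in a fixed environment -/

/-- The one-step transition kernel of the walk in the environment `ω`: from `y` jump to `y + e`
with probability `ω(y, e)`. -/
def walkKernel {d : ℕ} (ω : Env d) : Kernel (Fin d → ℤ) (Fin d → ℤ) where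
  toFun y := ∑ e : Jump d, ENNReal.ofReal (ω y e) • Measure.dirac (y + e.1)
  measurable' := Measurable.of_discrete

instance {d : ℕ} (ω : Env d) : IsMarkovKernel (walkKernel ω) where
  isProbabilityMeasure y := ⟨by simp [walkKernel, sum_prob]⟩

/-- The quenched law `P_{x,ω}` on `(ℤ^d)^ℕ` of the random walk in the environment `ω` started in
`x`: the Markov chain with initial state `x` and transition kernel `walkKernel ω`. -/
def quenchedLaw {d : ℕ} (x : Fin d → ℤ) (ω : Env d) : Measure (ℕ → Fin d → ℤ) :=
  Kernel.trajMeasure (X := fun _ => Fin d → ℤ) (Measure.dirac x)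
    fun n => (walkKernel ω).comap (fun h => h ⟨n, Finset.mem_Iic.2 le_rfl⟩)
      (measurable_pi_apply _)

instance {d : ℕ} (x : Fin d → ℤ) (ω : Env d) : IsProbabilityMeasure (quenchedLaw x ω) := by
  unfold quenchedLaw; infer_instance

theorem quenchedLaw_prefix_zero {d : ℕ} (x : Fin d → ℤ) (ω : Env d)
    (a : Finset.Iic 0 → Fin d → ℤ) :
    quenchedLaw x ω (Preorder.frestrictLe (π := fun _ => Fin d → ℤ) 0 ⁻¹' {a}) =
      Set.indicator {a} 1 (fun _ => x) := by
  have hm : Measurable (Preorder.frestrictLe (π := fun _ : ℕ => Fin d → ℤ) 0) :=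
    Preorder.measurable_frestrictLe 0
  rw [← Measure.map_apply hm (measurableSet_singleton a), quenchedLaw, Kernel.trajMeasure,
    Measure.map_comp _ _ hm, Kernel.traj_map_frestrictLe, Kernel.partialTraj_self,
    Measure.id_comp]
  refine (congrArg (fun m : Measure (Finset.Iic 0 → Fin d → ℤ) => m {a})
    (Measure.map_dirac' (MeasurableEquiv.measurable _) x)).trans ?_
  rw [Measure.dirac_apply' _ (measurableSet_singleton a)]
  rfl

theorem quenchedLaw_prefix_succ {d : ℕ} (x : Fin d → ℤ) (ω : Env d) (n : ℕ)
    (a : Finset.Iic (n + 1) → Fin d → ℤ) :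
    quenchedLaw x ω (Preorder.frestrictLe (π := fun _ => Fin d → ℤ) (n + 1) ⁻¹' {a}) =
      walkKernel ω (a ⟨n, Finset.mem_Iic.2 n.le_succ⟩) {a ⟨n + 1, Finset.mem_Iic.2 le_rfl⟩} *
      quenchedLaw x ω (Preorder.frestrictLe (π := fun _ => Fin d → ℤ) n ⁻¹'
        {Preorder.frestrictLe₂ (π := fun _ => Fin d → ℤ) n.le_succ a}) := by
  have hm : Measurable (Preorder.frestrictLe (π := fun _ : ℕ => Fin d → ℤ) n) :=
    Preorder.measurable_frestrictLe n
  have hset : Preorder.frestrictLe (π := fun _ => Fin d → ℤ) (n + 1) ⁻¹' {a} =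
      (fun p : ℕ → Fin d → ℤ => (Preorder.frestrictLe (π := fun _ => Fin d → ℤ) n p, p (n + 1))) ⁻¹'
        ({Preorder.frestrictLe₂ (π := fun _ => Fin d → ℤ) n.le_succ a} ×ˢ
          {a ⟨n + 1, Finset.mem_Iic.2 le_rfl⟩}) := by
    ext p
    simp only [Set.mem_preimage, Set.mem_singleton_iff, Set.mem_prod, funext_iff]
    constructor
    · exact fun h => ⟨fun i => h ⟨i, _⟩, h ⟨n + 1, _⟩⟩
    · rintro ⟨h1, h2⟩ ⟨i, hi⟩
      rcases Nat.of_le_succ (Finset.mem_Iic.1 hi) with h | h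
      · exact h1 ⟨i, Finset.mem_Iic.2 h⟩
      · subst h; exact h2
  have key := Kernel.map_frestrictLe_trajMeasure_compProd_eq_map_trajMeasure
    (X := fun _ => Fin d → ℤ) (μ₀ := Measure.dirac x) (a := n)
    (κ := fun n => (walkKernel ω).comap (fun h => h ⟨n, Finset.mem_Iic.2 le_rfl⟩)
      (measurable_pi_apply _))
  rw [hset, ← Measure.map_apply (by fun_prop)
    ((measurableSet_singleton _).prod (measurableSet_singleton _))]
  change (Measure.map _ (Kernel.trajMeasure _ _)) _ = _
  rw [← key, Measure.compProd_apply_prod (measurableSet_singleton _) (measurableSet_singleton _),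
    lintegral_singleton, Measure.map_apply hm (measurableSet_singleton _)]
  rfl

theorem measurable_quenchedLaw {d : ℕ} (x : Fin d → ℤ) :
    Measurable (quenchedLaw x : Env d → Measure (ℕ → Fin d → ℤ)) := by
  have hpre : ∀ (n : ℕ) (a : Finset.Iic n → Fin d → ℤ), Measurable fun ω : Env d =>
      quenchedLaw x ω (Preorder.frestrictLe (π := fun _ => Fin d → ℤ) n ⁻¹' {a}) := by
    intro n
    induction n with
    | zero => intro a; simp only [quenchedLaw_prefix_zero]; exact measurable_const
    | succ n ih =>
      intro a
      simp only [quenchedLaw_prefix_succ]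
      refine Measurable.mul ?_ (ih _)
      simp only [walkKernel, Kernel.coe_mk, Measure.finsetSum_apply, Measure.smul_apply,
        smul_eq_mul]
      exact Finset.measurable_sum _ fun e _ => (measurable_prob _ e).mul_const _
  refine Measurable.measure_of_isPiSystem_of_isProbabilityMeasure
    generateFrom_measurableCylinders.symm isPiSystem_measurableCylinders fun s hs => ?_
  rw [measurableCylinders_nat] at hs
  simp only [Set.mem_iUnion, Set.mem_singleton_iff] at hs
  obtain ⟨n, S, hS, rfl⟩ := hs
  have hsum : ∀ ω : Env d, quenchedLaw x ω (cylinder (Finset.Iic n) S) =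
      ∑' a : S, quenchedLaw x ω (Preorder.frestrictLe (π := fun _ => Fin d → ℤ) n ⁻¹' {a.1}) := by
    intro ω
    rw [tsum_measure_preimage_singleton S.to_countable fun a _ =>
      Preorder.measurable_frestrictLe n (measurableSet_singleton a)]
    rfl
  simp only [hsum]
  exact Measurable.tsum fun a => hpre n a

/-! ### The environment viewed from the particle -/

/-- The environment viewed from the particle, `n ↦ t_{X_n} ω`, as a function of the environment
and of the trajectory of the walk. -/
def envProcess {d : ℕ} (ω : Env d) (X : ℕ → Fin d → ℤ) : ℕ → Env d :=
  fun n => translate (X n) ω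

/-- The law `P_ω` on `Ω^ℕ` of the environment viewed from the particle, for the walk started in
`0` in the environment `ω`. -/
def envLaw {d : ℕ} (ω : Env d) : Measure (ℕ → Env d) :=
  (quenchedLaw 0 ω).map (envProcess ω)

/-- `ω ↦ P_ω` is measurable, so that `∫ P_ω ν(dω)` makes sense. -/
theorem measurable_envLaw {d : ℕ} : Measurable (envLaw : Env d → Measure (ℕ → Env d)) := by
  have hg : Measurable fun q : Env d × (ℕ → Fin d → ℤ) => envProcess q.1 q.2 := by
    refine measurable_pi_lambda _ fun n => ?_
    have h : Measurable fun q : Env d × (Fin d → ℤ) => translate q.2 q.1 :=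
      measurable_from_prod_countable_left fun y => measurable_translate y
    exact h.comp (measurable_fst.prodMk ((measurable_pi_apply n).comp measurable_snd))
  let κ : Kernel (Env d) (ℕ → Fin d → ℤ) := ⟨quenchedLaw 0, measurable_quenchedLaw 0⟩
  have : IsMarkovKernel κ := ⟨fun ω => inferInstanceAs (IsProbabilityMeasure (quenchedLaw 0 ω))⟩
  have heq : (envLaw : Env d → Measure (ℕ → Env d)) =
      fun ω => ((Kernel.id ×ₖ κ).map fun q => envProcess q.1 q.2) ω := by
    funext ω
    rw [Kernel.map_apply _ hg, Kernel.prod_apply, Kernel.id_apply, Measure.dirac_prod,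
      Measure.map_map hg measurable_prodMk_left]
    rfl
  rw [heq]
  exact Kernel.measurable _

/-- The law `P_ν = ∫ P_ω ν(dω)` of the environment viewed from the particle with initial
law `ν`. -/
def envLawFrom {d : ℕ} (ν : Measure (Env d)) : Measure (ℕ → Env d) := ν.bind envLaw

instance {d : ℕ} (ω : Env d) : IsProbabilityMeasure (envLaw ω) :=
  Measure.isProbabilityMeasure_map (measurable_pi_lambda _ fun n =>
    (Measurable.of_discrete (f := fun y => translate y ω)).comp
      (measurable_pi_apply n)).aemeasurable

instance {d : ℕ} (ν : Measure (Env d)) [IsProbabilityMeasure ν] :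
    IsProbabilityMeasure (envLawFrom ν) :=
  isProbabilityMeasure_bind measurable_envLaw.aemeasurable (ae_of_all _ fun _ => inferInstance)

/-- The canonical shift `θ` on `Ω^ℕ`. -/
def shift {d : ℕ} (γ : ℕ → Env d) : ℕ → Env d := fun n => γ (n + 1)

/-- The transition operator `R f(ω) = ∑_e ω(0, e) f(t_e ω)` of the environmental process. -/
def transitionOp {d : ℕ} (f : Env d → ℝ) (ω : Env d) : ℝ :=
  ∑ e : Jump d, ω 0 e * f (translate e.1 ω)

/-- The transition kernel `R` of the environmental process, as a Markov kernel on `Ω`. -/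
def envKernel (d : ℕ) : Kernel (Env d) (Env d) where
  toFun ω := ∑ e : Jump d, ENNReal.ofReal (ω 0 e) • Measure.dirac (translate e.1 ω)
  measurable' := by
    refine Measure.measurable_of_measurable_coe _ fun s hs => ?_
    simp only [Measure.finsetSum_apply, Measure.smul_apply, smul_eq_mul]
    refine Finset.measurable_sum _ fun e _ => (measurable_prob 0 e).mul ?_
    exact (Measure.measurable_coe hs).comp (Measure.measurable_dirac.comp (measurable_translate _))

instance (d : ℕ) : IsMarkovKernel (envKernel d) where
  isProbabilityMeasure ω := ⟨by simp [envKernel, sum_prob]⟩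

/-- The probability measure `μ R`. -/
def stepLaw {d : ℕ} (μ : ProbabilityMeasure (Env d)) : ProbabilityMeasure (Env d) :=
  ⟨(μ : Measure (Env d)).bind (envKernel d), inferInstance⟩

/-- The measure `μ R` satisfies `∫ f d(μ R) = ∫ R f dμ` for bounded continuous `f`. -/
theorem integral_stepLaw {d : ℕ} (μ : ProbabilityMeasure (Env d))
    (f : BoundedContinuousFunction (Env d) ℝ) :
    ∫ ω, f ω ∂(stepLaw μ : Measure (Env d)) = ∫ ω, transitionOp f ω ∂(μ : Measure (Env d)) := by
  change ∫ ω, f ω ∂((μ : Measure (Env d)).bind (envKernel d)) = _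
  rw [Measure.comp_eq_comp_const_apply, Kernel.integral_comp (f.integrable _), Kernel.const_apply]
  refine integral_congr_ae (ae_of_all _ fun ω => ?_)
  change ∫ x, f x ∂(∑ e : Jump d, ENNReal.ofReal (ω 0 e) • Measure.dirac (translate e.1 ω)) = _
  rw [integral_finsetSum_measure]
  · refine Finset.sum_congr rfl fun e _ => ?_
    rw [integral_smul_measure, integral_dirac, ENNReal.toReal_ofReal (stdSimplex.zero_le (ω 0) e), smul_eq_mul]
  · exact fun e _ => (f.integrable _).smul_measure ENNReal.ofReal_ne_top

/-- `μ` is an invariant probability measure for the environmental process: `μ R = μ`. -/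
def IsInvariant {d : ℕ} (μ : ProbabilityMeasure (Env d)) : Prop := stepLaw μ = μ

/-- The Cesàro mean `(n + 1)⁻¹ ∑_{i = 0}^n μ R^i`. -/
def cesaroMean {d : ℕ} (μ : ProbabilityMeasure (Env d)) (n : ℕ) : ProbabilityMeasure (Env d) :=
  ⟨((n : ENNReal) + 1)⁻¹ •
      ∑ i ∈ Finset.range (n + 1), ((stepLaw^[i] μ : ProbabilityMeasure (Env d)) : Measure (Env d)),
    ⟨by
      simp only [Measure.smul_apply, Measure.finsetSum_apply, measure_univ, Finset.sum_const,
        Finset.card_range, nsmul_eq_mul, mul_one, smul_eq_mul, Nat.cast_add, Nat.cast_one]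
      exact ENNReal.inv_mul_cancel (by simp) (by finiteness)⟩⟩

/-! ### Assumptions on the law of the environment -/

/-- Ellipticity: for every `x`, almost surely `min_e ω(x, e) > 0`. -/
def IsElliptic {d : ℕ} (P : ProbabilityMeasure (Env d)) : Prop :=
  ∀ x : Fin d → ℤ, ∀ᵐ ω ∂(P : Measure (Env d)), ∀ e : Jump d, 0 < ω x e

/-- Total ergodicity: events that are invariant under all translations have probability
`0` or `1`. -/
def IsTotallyErgodic {d : ℕ} (P : ProbabilityMeasure (Env d)) : Prop :=
  ∀ A : Set (Env d), MeasurableSet A → (∀ x : Fin d → ℤ, translate x ⁻¹' A = A) →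
    (P : Measure (Env d)) A = 0 ∨ (P : Measure (Env d)) A = 1

end RWRE

end

/-- **Mean ergodic theorem for absolutely continuous initial laws.** If `T` is ergodic for the
probability measure `μ` and `F` is bounded and measurable, then the time averages of `F` have
asymptotically constant mean under every probability measure that is absolutely continuous with
respect to `μ`. -/
theorem Ergodic.exists_tendsto_average_integral {α : Type*} [MeasurableSpace α] {μ : Measure α}
    [IsProbabilityMeasure μ] {T : α → α} (hT : Ergodic T μ) {F : α → ℝ} (hF : Measurable F)
    {C : ℝ} (hC : ∀ x, ‖F x‖ ≤ C) :
    ∃ c : ℝ, ∀ μ' : Measure α, IsProbabilityMeasure μ' → μ' ≪ μ →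
      Tendsto (fun n : ℕ => (n : ℝ)⁻¹ * ∑ i ∈ Finset.range n, ∫ x, F (T^[i] x) ∂μ') atTop (𝓝 c) := by
  have hFL : ∀ i, MemLp (fun x => F (T^[i] x)) 2 μ := fun i =>
    MemLp.of_bound ((hF.comp (hT.measurable.iterate i)).aestronglyMeasurable) C
      (ae_of_all _ fun x => hC _)
  let U : Lp ℝ 2 μ →ₗᵢ[ℝ] Lp ℝ 2 μ := Lp.compMeasurePreservingₗᵢ ℝ T hT.toMeasurePreserving
  have hU : ∀ i, U^[i] (hFL 0).toLp = (hFL i).toLp := by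
    intro i
    induction i with
    | zero => rfl
    | succ i ih =>
      rw [Function.iterate_succ_apply', ih]
      rfl
  have hlim := U.toContinuousLinearMap.tendsto_birkhoffAverage_orthogonalProjection
    U.norm_toContinuousLinearMap_le (hFL 0).toLp
  set G : Lp ℝ 2 μ :=
    ((U.toContinuousLinearMap.eqLocus (1 : Lp ℝ 2 μ →L[ℝ] Lp ℝ 2 μ)).orthogonalProjectionOnto
      (hFL 0).toLp : Lp ℝ 2 μ)
  have hGfix : U G = G :=
    ((U.toContinuousLinearMap.eqLocus (1 : Lp ℝ 2 μ →L[ℝ] Lp ℝ 2 μ)).orthogonalProjectionOnto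
      (hFL 0).toLp).2
  obtain ⟨c, hc⟩ : ∃ c : ℝ, (G : α → ℝ) =ᵐ[μ] Function.const α c := by
    refine hT.ae_eq_const_of_ae_eq_comp_ae (Lp.aestronglyMeasurable G) ?_
    have := Lp.coeFn_compMeasurePreserving G hT.toMeasurePreserving
    have h2 : Lp.compMeasurePreserving T hT.toMeasurePreserving G = G := hGfix
    rw [h2] at this
    exact this.symm
  let A : ℕ → α → ℝ := fun n x => (n : ℝ)⁻¹ * ∑ i ∈ Finset.range n, F (T^[i] x)
  have hAm : ∀ n, Measurable (A n) := fun n =>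
    (Finset.measurable_sum _ fun i _ => hF.comp (hT.measurable.iterate i)).const_mul _
  have hAb : ∀ n x, ‖A n x‖ ≤ C := by
    intro n x
    have hC0 : 0 ≤ C := (norm_nonneg _).trans (hC x)
    rcases Nat.eq_zero_or_pos n with rfl | hn
    · simpa [A] using hC0
    have hn' : (0 : ℝ) < n := Nat.cast_pos.2 hn
    have h1 : ‖∑ i ∈ Finset.range n, F (T^[i] x)‖ ≤ n * C := by
      simpa using norm_sum_le_of_le (Finset.range n) fun i _ => hC (T^[i] x)
    calc ‖A n x‖ = (n : ℝ)⁻¹ * ‖∑ i ∈ Finset.range n, F (T^[i] x)‖ := by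
          simp only [A, norm_mul, norm_inv, RCLike.norm_natCast]
      _ ≤ (n : ℝ)⁻¹ * (n * C) := by gcongr
      _ = C := by field_simp
  have hAe : ∀ n, ((birkhoffAverage ℝ U.toContinuousLinearMap _root_.id n (hFL 0).toLp : Lp ℝ 2 μ) : α → ℝ)
      =ᵐ[μ] A n := by
    intro n
    have h1 : birkhoffAverage ℝ U.toContinuousLinearMap _root_.id n (hFL 0).toLp =
        (n : ℝ)⁻¹ • ∑ i ∈ Finset.range n, (hFL i).toLp := by
      rw [birkhoffAverage, birkhoffSum]
      congr 1
      exact Finset.sum_congr rfl fun i _ => hU i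
    rw [h1]
    filter_upwards [Lp.coeFn_smul (n : ℝ)⁻¹ (∑ i ∈ Finset.range n, (hFL i).toLp),
      Lp.coeFn_finsetSum (Finset.range n) (fun i => (hFL i).toLp),
      ae_all_iff.2 fun i => (hFL i).coeFn_toLp] with x h1 h2 h3
    rw [h1, Pi.smul_apply, h2, smul_eq_mul]
    simp only [Finset.sum_apply, h3, A]
  have hmeas : TendstoInMeasure μ A atTop (Function.const α c) :=
    (tendstoInMeasure_of_tendsto_Lp hlim).congr hAe hc
  refine ⟨c, fun μ' _ hac => ?_⟩
  have hint : ∀ n : ℕ, (n : ℝ)⁻¹ * ∑ i ∈ Finset.range n, ∫ x, F (T^[i] x) ∂μ' = ∫ x, A n x ∂μ' := by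
    intro n
    simp only [A]
    rw [integral_const_mul, integral_finsetSum]
    exact fun i _ => Integrable.of_bound
      ((hF.comp (hT.measurable.iterate i)).aestronglyMeasurable) C (ae_of_all _ fun x => hC _)
  simp only [hint]
  refine tendsto_of_subseq_tendsto fun ns hns => ?_
  obtain ⟨ms, -, hms⟩ := (hmeas.comp hns).exists_seq_tendsto_ae
  refine ⟨ms, ?_⟩
  have := tendsto_integral_of_dominated_convergence (μ := μ') (F := fun k => A (ns (ms k)))
    (f := fun _ => c) (fun _ => C) (fun k => (hAm _).aestronglyMeasurable) (integrable_const C)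
    (fun k => ae_of_all _ fun x => hAb _ x) (hac.ae_le hms)
  simpa using this

/-- If `T` is ergodic for `μ`, then the time averages of a bounded measurable function converge in
mean to its `μ`-integral, under every probability measure absolutely continuous with respect to
`μ`. -/
theorem Ergodic.tendsto_average_integral {α : Type*} [MeasurableSpace α] {μ μ' : Measure α}
    [IsProbabilityMeasure μ] [IsProbabilityMeasure μ'] {T : α → α} (hT : Ergodic T μ)
    (hac : μ' ≪ μ) {F : α → ℝ} (hF : Measurable F) {C : ℝ} (hC : ∀ x, ‖F x‖ ≤ C) :
    Tendsto (fun n : ℕ => (n : ℝ)⁻¹ * ∑ i ∈ Finset.range n, ∫ x, F (T^[i] x) ∂μ') atTop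
      (𝓝 (∫ x, F x ∂μ)) := by
  obtain ⟨c, hc⟩ := hT.exists_tendsto_average_integral hF hC
  have hi : ∀ i, ∫ x, F (T^[i] x) ∂μ = ∫ x, F x ∂μ := fun i => by
    have hmp := hT.toMeasurePreserving.iterate i
    rw [← integral_map hmp.measurable.aemeasurable hF.aestronglyMeasurable, hmp.map_eq]
  have h1 : Tendsto (fun _ : ℕ => ∫ x, F x ∂μ) atTop (𝓝 c) := by
    refine (hc μ inferInstance Measure.AbsolutelyContinuous.rfl).congr' ?_
    filter_upwards [eventually_gt_atTop 0] with n hn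
    have hn' : (n : ℝ) ≠ 0 := Nat.cast_ne_zero.2 hn.ne'
    simp only [hi, Finset.sum_const, Finset.card_range, nsmul_eq_mul]
    field_simp
  rw [tendsto_nhds_unique tendsto_const_nhds h1]
  exact hc μ' inferInstance hac

noncomputable section

namespace RWRE

/-! ### The law of the walk on cylinders -/

/-- Trajectories that agree with `p` up to time `n`. -/
def prefixSet {S : Type*} (n : ℕ) (p : ℕ → S) : Set (ℕ → S) := {q | ∀ i ≤ n, q i = p i}

theorem prefixSet_eq_preimage {S : Type*} (n : ℕ) (p : ℕ → S) :
    prefixSet n p = Preorder.frestrictLe (π := fun _ => S) n ⁻¹'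
      {Preorder.frestrictLe (π := fun _ => S) n p} := by
  ext q
  simp only [prefixSet, Set.mem_ofPred_eq, Set.mem_preimage, Set.mem_singleton_iff, funext_iff]
  exact ⟨fun h i => h i (Finset.mem_Iic.1 i.2), fun h i hi => h ⟨i, Finset.mem_Iic.2 hi⟩⟩

theorem measurableSet_prefixSet {S : Type*} [Countable S] [MeasurableSpace S]
    [MeasurableSingletonClass S] (n : ℕ) (p : ℕ → S) : MeasurableSet (prefixSet n p) := by
  rw [prefixSet_eq_preimage]
  exact Preorder.measurable_frestrictLe n (measurableSet_singleton _)

/-- A probability measure on trajectories in a countable space is determined by its values on prefix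
sets. -/
theorem measure_ext_of_prefixSet {S : Type*} [Countable S] [MeasurableSpace S]
    [MeasurableSingletonClass S] {μ μ' : Measure (ℕ → S)} [IsProbabilityMeasure μ]
    [IsProbabilityMeasure μ'] (h : ∀ n p, μ (prefixSet n p) = μ' (prefixSet n p)) : μ = μ' := by
  refine ext_of_generate_finite _ generateFrom_measurableCylinders.symm
    isPiSystem_measurableCylinders (fun s hs => ?_) (by simp)
  rw [measurableCylinders_nat] at hs
  simp only [Set.mem_iUnion, Set.mem_singleton_iff] at hs
  obtain ⟨n, D, hD, rfl⟩ := hs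
  have key : ∀ a : Finset.Iic n → S,
      μ (Preorder.frestrictLe (π := fun _ => S) n ⁻¹' {a}) =
        μ' (Preorder.frestrictLe (π := fun _ => S) n ⁻¹' {a}) := by
    intro a
    have ha : a = Preorder.frestrictLe (π := fun _ => S) n
        (fun i => a ⟨min i n, Finset.mem_Iic.2 (min_le_right _ _)⟩) := by
      funext i
      have hi : min i.1 n = i.1 := min_eq_left (Finset.mem_Iic.1 i.2)
      simp only [Preorder.frestrictLe_apply]
      congr 1
      exact Subtype.ext hi.symm
    rw [ha, ← prefixSet_eq_preimage]
    exact h _ _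
  have hsum : ∀ ρ : Measure (ℕ → S), ρ (cylinder (Finset.Iic n) D) =
      ∑' a : D, ρ (Preorder.frestrictLe (π := fun _ => S) n ⁻¹' {a.1}) := by
    intro ρ
    rw [tsum_measure_preimage_singleton D.to_countable fun a _ =>
      Preorder.measurable_frestrictLe n (measurableSet_singleton a)]
    rfl
  rw [hsum, hsum]
  exact tsum_congr fun a => key a

theorem quenchedLaw_prefixSet {d : ℕ} (x : Fin d → ℤ) (ω : Env d) (n : ℕ)
    (p : ℕ → Fin d → ℤ) :
    quenchedLaw x ω (prefixSet n p) =
      (if x = p 0 then 1 else 0) * ∏ i ∈ Finset.range n, walkKernel ω (p i) {p (i + 1)} := by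
  induction n with
  | zero =>
    rw [prefixSet_eq_preimage, quenchedLaw_prefix_zero]
    simp only [Finset.range_zero, Finset.prod_empty, mul_one]
    by_cases hx : x = p 0
    · rw [if_pos hx, Set.indicator_of_mem]
      · rfl
      · refine Set.mem_singleton_iff.2 (funext fun i => ?_)
        have : (i : ℕ) = 0 := Nat.le_zero.1 (Finset.mem_Iic.1 i.2)
        simp [hx, this]
    · rw [if_neg hx, Set.indicator_of_notMem]
      exact fun h => hx (congrFun (Set.mem_singleton_iff.1 h) ⟨0, Finset.mem_Iic.2 le_rfl⟩)
  | succ n ih =>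
    rw [prefixSet_eq_preimage, quenchedLaw_prefix_succ, Finset.prod_range_succ, ← mul_assoc,
      ← ih, prefixSet_eq_preimage, mul_comm]
    rfl

theorem walkKernel_translate {d : ℕ} (ω : Env d) (y a b : Fin d → ℤ) :
    walkKernel (translate y ω) a {b} = walkKernel ω (a + y) {b + y} := by
  simp only [walkKernel, Kernel.coe_mk, Measure.finsetSum_apply, Measure.smul_apply, smul_eq_mul,
    translate]
  refine Finset.sum_congr rfl fun e _ => ?_
  congr 1
  rw [Measure.dirac_apply' _ (measurableSet_singleton _),
    Measure.dirac_apply' _ (measurableSet_singleton _)]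
  simp only [Set.indicator_apply, Set.mem_singleton_iff]
  have : a + y + e.1 = b + y ↔ a + e.1 = b := by
    rw [add_right_comm, add_left_inj]
  simp only [this, Pi.one_apply]

/-- The trajectory that starts in `a` and continues as `γ`. -/
def cons {S : Type*} (a : S) (γ : ℕ → S) : ℕ → S
  | 0 => a
  | n + 1 => γ n

theorem measurable_cons {S : Type*} [MeasurableSpace S] (a : S) :
    Measurable (cons a : (ℕ → S) → ℕ → S) :=
  measurable_pi_lambda _ fun n => match n with
    | 0 => measurable_const
    | n + 1 => measurable_pi_apply n

/-- One-step decomposition of the walk: after the first jump `e` it moves like the walk from the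
origin in the environment translated by `e`. -/
theorem quenchedLaw_zero_eq_sum {d : ℕ} (ω : Env d) :
    quenchedLaw 0 ω = ∑ e : Jump d, ENNReal.ofReal (ω 0 e) •
      (quenchedLaw 0 (translate e.1 ω)).map (fun X => cons 0 fun n => X n + e.1) := by
  have hm : ∀ e : Jump d,
      Measurable fun X : ℕ → Fin d → ℤ => cons (0 : Fin d → ℤ) fun n => X n + e.1 := fun e =>
    (measurable_cons 0).comp (measurable_pi_lambda _ fun n =>
      (measurable_pi_apply n).add_const _)
  have hp : IsProbabilityMeasure (∑ e : Jump d, ENNReal.ofReal (ω 0 e) •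
      (quenchedLaw 0 (translate e.1 ω)).map (fun X => cons 0 fun n => X n + e.1)) := by
    constructor
    simp only [Measure.finsetSum_apply, Measure.smul_apply, smul_eq_mul]
    rw [← sum_prob ω 0]
    refine Finset.sum_congr rfl fun e _ => ?_
    rw [Measure.map_apply (hm e) MeasurableSet.univ]
    simp
  refine measure_ext_of_prefixSet fun n p => ?_
  simp only [Measure.finsetSum_apply, Measure.smul_apply, smul_eq_mul]
  rw [quenchedLaw_prefixSet]
  by_cases h0 : 0 = p 0
  swap
  · rw [if_neg h0, zero_mul, eq_comm]
    refine Finset.sum_eq_zero fun e _ => ?_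
    rw [Measure.map_apply (hm e) (measurableSet_prefixSet n p)]
    convert mul_zero _
    convert measure_empty (μ := quenchedLaw 0 (translate e.1 ω))
    refine Set.eq_empty_of_forall_notMem fun X hX => h0 (hX 0 (Nat.zero_le n))
  rw [if_pos h0, one_mul]
  cases n with
  | zero =>
    rw [Finset.range_zero, Finset.prod_empty, ← sum_prob ω 0]
    refine Finset.sum_congr rfl fun e _ => ?_
    rw [Measure.map_apply (hm e) (measurableSet_prefixSet 0 p)]
    convert (mul_one _).symm
    convert measure_univ (μ := quenchedLaw 0 (translate e.1 ω))
    refine Set.eq_univ_of_forall fun X i hi => ?_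
    obtain rfl := Nat.le_zero.1 hi
    exact h0
  | succ n =>
    have hpre : ∀ e : Jump d, (fun X : ℕ → Fin d → ℤ => cons (0 : Fin d → ℤ) fun n => X n + e.1) ⁻¹'
        prefixSet (n + 1) p = prefixSet n fun i => p (i + 1) - e.1 := by
      intro e
      ext X
      simp only [prefixSet, Set.mem_preimage, Set.mem_ofPred_eq]
      constructor
      · exact fun h i hi => eq_sub_of_add_eq (h (i + 1) (Nat.succ_le_succ hi))
      · rintro h (_ | i) hi
        · exact h0
        · exact add_eq_of_eq_sub (h i (Nat.le_of_succ_le_succ hi))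
    rw [Finset.prod_range_succ', ← h0, mul_comm]
    nth_rewrite 1 [walkKernel]
    simp only [Kernel.coe_mk, Measure.finsetSum_apply, Measure.smul_apply, smul_eq_mul,
      Finset.sum_mul]
    refine Finset.sum_congr rfl fun e _ => ?_
    rw [Measure.map_apply (hm e) (measurableSet_prefixSet _ p), hpre, quenchedLaw_prefixSet,
      mul_assoc]
    simp only [walkKernel_translate, sub_add_cancel]
    congr 2
    rw [Measure.dirac_apply' _ (measurableSet_singleton _)]
    simp only [Set.indicator_apply, Set.mem_singleton_iff, zero_add, Pi.one_apply]
    congr 1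
    rw [eq_comm (a := (0 : Fin d → ℤ)), sub_eq_zero]
    exact propext eq_comm

/-! ### The Markov property of the environment viewed from the particle -/

theorem translate_zero {d : ℕ} (ω : Env d) : translate 0 ω = ω :=
  funext fun x => congrArg ω (add_zero x)

theorem translate_translate {d : ℕ} (x y : Fin d → ℤ) (ω : Env d) :
    translate x (translate y ω) = translate (x + y) ω :=
  funext fun z => congrArg ω (add_assoc z x y)

theorem measurable_envProcess {d : ℕ} (ω : Env d) : Measurable (envProcess ω) :=
  measurable_pi_lambda _ fun n =>
    (Measurable.of_discrete (f := fun y => translate y ω)).comp (measurable_pi_apply n)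

/-- One-step decomposition of the environment viewed from the particle. -/
theorem envLaw_eq_sum {d : ℕ} (ω : Env d) :
    envLaw ω = ∑ e : Jump d, ENNReal.ofReal (ω 0 e) •
      (envLaw (translate e.1 ω)).map (cons ω) := by
  have hm : ∀ e : Jump d,
      Measurable fun X : ℕ → Fin d → ℤ => cons (0 : Fin d → ℤ) fun n => X n + e.1 := fun e =>
    (measurable_cons 0).comp (measurable_pi_lambda _ fun n =>
      (measurable_pi_apply n).add_const _)
  ext s hs
  rw [envLaw, Measure.map_apply (measurable_envProcess ω) hs, quenchedLaw_zero_eq_sum]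
  simp only [Measure.finsetSum_apply, Measure.smul_apply, smul_eq_mul]
  refine Finset.sum_congr rfl fun e _ => ?_
  congr 1
  rw [Measure.map_apply (hm e) (measurable_envProcess ω hs),
    Measure.map_apply (measurable_cons ω) hs, envLaw,
    Measure.map_apply (measurable_envProcess _) (measurable_cons ω hs)]
  congr 1
  ext X
  simp only [Set.mem_preimage]
  suffices h : envProcess ω (cons 0 fun n => X n + e.1) =
      cons ω (envProcess (translate e.1 ω) X) by rw [h]
  funext n
  cases n with
  | zero => exact translate_zero ω
  | succ n => exact (translate_translate _ _ _).symm

theorem envLaw_apply {d : ℕ} (ω : Env d) {s : Set (ℕ → Env d)} (hs : MeasurableSet s) :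
    envLaw ω s = ∑ e : Jump d, ENNReal.ofReal (ω 0 e) *
      envLaw (translate e.1 ω) (cons ω ⁻¹' s) := by
  conv_lhs => rw [envLaw_eq_sum]
  simp only [Measure.finsetSum_apply, Measure.smul_apply, smul_eq_mul]
  exact Finset.sum_congr rfl fun e _ => by rw [Measure.map_apply (measurable_cons ω) hs]

theorem lintegral_envLaw {d : ℕ} (ω : Env d) {f : (ℕ → Env d) → ENNReal} (hf : Measurable f) :
    ∫⁻ γ, f γ ∂envLaw ω = ∑ e : Jump d, ENNReal.ofReal (ω 0 e) *
      ∫⁻ γ, f (cons ω γ) ∂envLaw (translate e.1 ω) := by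
  conv_lhs => rw [envLaw_eq_sum]
  rw [lintegral_finsetSum_measure]
  exact Finset.sum_congr rfl fun e _ => by
    rw [lintegral_smul_measure, lintegral_map hf (measurable_cons ω), smul_eq_mul]

theorem ae_envLaw_apply_zero {d : ℕ} (ω : Env d) : ∀ᵐ γ ∂envLaw ω, γ 0 = ω := by
  have hs : MeasurableSet {γ : ℕ → Env d | γ 0 = ω} :=
    (measurable_pi_apply (X := fun _ : ℕ => Env d) 0) (measurableSet_singleton ω)
  rw [ae_iff]
  change envLaw ω {γ | γ 0 = ω}ᶜ = 0
  rw [envLaw_apply ω hs.compl]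
  refine Finset.sum_eq_zero fun e _ => ?_
  convert mul_zero _
  convert measure_empty (μ := envLaw (translate e.1 ω))
  exact Set.eq_empty_of_forall_notMem fun γ h => h rfl

theorem measurable_shift {d : ℕ} : Measurable (shift : (ℕ → Env d) → ℕ → Env d) :=
  measurable_pi_lambda _ fun n => measurable_pi_apply (n + 1)

theorem shift_iterate_apply {d : ℕ} (n k : ℕ) (γ : ℕ → Env d) : shift^[n] γ k = γ (k + n) := by
  induction n generalizing γ with
  | zero => rfl
  | succ n ih => rw [Function.iterate_succ_apply, ih]; exact congrArg γ (by omega)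

theorem measurable_envLaw_apply {d : ℕ} {s : Set (ℕ → Env d)} (hs : MeasurableSet s) :
    Measurable fun ω => envLaw ω s := (Measure.measurable_coe hs).comp measurable_envLaw

/-- Markov property at time `n`, for events `C` that depend only on the first coordinates. -/
theorem envLaw_inter_shift_preimage {d : ℕ} {A : Set (ℕ → Env d)} (hA : MeasurableSet A) (n : ℕ)
    {C : Set (ℕ → Env d)} (hC : MeasurableSet C)
    (hCn : ∀ γ γ' : ℕ → Env d, (∀ i ≤ n, γ i = γ' i) → γ ∈ C → γ' ∈ C) (ω : Env d) :
    envLaw ω (C ∩ shift^[n] ⁻¹' A) = ∫⁻ γ in C, envLaw (γ n) A ∂envLaw ω := by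
  have hm : ∀ n, Measurable fun γ : ℕ → Env d => envLaw (γ n) A := fun n =>
    (measurable_envLaw_apply hA).comp (measurable_pi_apply n)
  induction n generalizing C ω with
  | zero =>
    have h0 := ae_envLaw_apply_zero ω
    rw [← lintegral_indicator hC]
    by_cases h : (fun _ => ω) ∈ C
    · have hmem : ∀ᵐ γ ∂envLaw ω, γ ∈ C := h0.mono fun γ hγ =>
        hCn _ _ (fun i hi => by rw [Nat.le_zero.1 hi, hγ]) h
      have h1 : envLaw ω (C ∩ shift^[0] ⁻¹' A) = envLaw ω A := by
        refine measure_congr ?_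
        filter_upwards [hmem] with γ hγ
        exact propext ⟨fun h => h.2, fun h => ⟨hγ, h⟩⟩
      rw [h1, lintegral_congr_ae (g := fun _ => envLaw ω A)]
      · simp
      · filter_upwards [hmem, h0] with γ hγ hγ0
        rw [Set.indicator_of_mem hγ, hγ0]
    · have hmem : ∀ᵐ γ ∂envLaw ω, γ ∉ C := h0.mono fun γ hγ hγC =>
        h (hCn _ _ (fun i hi => by rw [Nat.le_zero.1 hi, hγ]) hγC)
      have h1 : envLaw ω (C ∩ shift^[0] ⁻¹' A) = 0 :=
        measure_mono_null Set.inter_subset_left (by simpa [ae_iff] using hmem)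
      rw [h1, lintegral_congr_ae (g := fun _ => 0)]
      · simp
      · filter_upwards [hmem] with γ hγ
        rw [Set.indicator_of_notMem hγ]
  | succ n ih =>
    rw [envLaw_apply ω (hC.inter ((measurable_shift.iterate _) hA)), ← lintegral_indicator hC,
      lintegral_envLaw ω ((hm _).indicator hC)]
    refine Finset.sum_congr rfl fun e _ => ?_
    congr 1
    have hC' : MeasurableSet (cons ω ⁻¹' C) := measurable_cons ω hC
    have h1 : cons ω ⁻¹' (C ∩ shift^[n + 1] ⁻¹' A) = cons ω ⁻¹' C ∩ shift^[n] ⁻¹' A := rfl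
    rw [h1, ih hC', ← lintegral_indicator hC']
    · rfl
    · intro γ γ' h hγ
      refine hCn (cons ω γ) _ ?_ hγ
      rintro (_ | i) hi
      · rfl
      · exact h i (Nat.le_of_succ_le_succ hi)

theorem envLawFrom_apply {d : ℕ} (μ : Measure (Env d)) {s : Set (ℕ → Env d)}
    (hs : MeasurableSet s) : envLawFrom μ s = ∫⁻ ω, envLaw ω s ∂μ :=
  Measure.bind_apply hs measurable_envLaw.aemeasurable

theorem lintegral_envLawFrom {d : ℕ} (μ : Measure (Env d)) {f : (ℕ → Env d) → ENNReal}
    (hf : Measurable f) : ∫⁻ γ, f γ ∂envLawFrom μ = ∫⁻ ω, ∫⁻ γ, f γ ∂envLaw ω ∂μ :=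
  Measure.lintegral_bind measurable_envLaw.aemeasurable hf.aemeasurable

theorem lintegral_envKernel {d : ℕ} (ω : Env d) {f : Env d → ENNReal} (hf : Measurable f) :
    ∫⁻ η, f η ∂envKernel d ω = ∑ e : Jump d, ENNReal.ofReal (ω 0 e) * f (translate e.1 ω) := by
  change ∫⁻ η, f η ∂(∑ e : Jump d, ENNReal.ofReal (ω 0 e) • Measure.dirac (translate e.1 ω)) = _
  rw [lintegral_finsetSum_measure]
  exact Finset.sum_congr rfl fun e _ => by
    rw [lintegral_smul_measure, lintegral_dirac' _ hf, smul_eq_mul]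

theorem envLaw_shift_preimage {d : ℕ} (ω : Env d) {s : Set (ℕ → Env d)} (hs : MeasurableSet s) :
    envLaw ω (shift ⁻¹' s) = ∑ e : Jump d, ENNReal.ofReal (ω 0 e) *
      envLaw (translate e.1 ω) s :=
  envLaw_apply ω (measurable_shift hs)

theorem map_shift_envLawFrom {d : ℕ} (μ : Measure (Env d)) :
    (envLawFrom μ).map shift = envLawFrom (μ.bind (envKernel d)) := by
  ext s hs
  have hm := measurable_envLaw_apply hs
  rw [Measure.map_apply measurable_shift hs, envLawFrom_apply _ (measurable_shift hs),
    envLawFrom_apply _ hs, Measure.lintegral_bind (envKernel d).measurable.aemeasurable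
      hm.aemeasurable]
  exact lintegral_congr fun ω => by rw [lintegral_envKernel ω hm, envLaw_shift_preimage ω hs]

theorem map_eval_zero_envLawFrom {d : ℕ} (μ : Measure (Env d)) :
    (envLawFrom μ).map (fun γ => γ 0) = μ := by
  ext s hs
  have hm : Measurable fun γ : ℕ → Env d => γ 0 := measurable_pi_apply 0
  rw [Measure.map_apply hm hs, envLawFrom_apply _ (hm hs), ← lintegral_indicator_one hs]
  refine lintegral_congr fun ω => ?_
  rw [← lintegral_indicator_one (hm hs), lintegral_congr_ae (g := fun _ => s.indicator 1 ω)]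
  · simp
  · filter_upwards [ae_envLaw_apply_zero ω] with γ hγ
    rw [← hγ]
    rfl

theorem map_shift_iterate_envLawFrom {d : ℕ} (μ : ProbabilityMeasure (Env d)) (i : ℕ) :
    (envLawFrom (μ : Measure (Env d))).map shift^[i] =
      envLawFrom ((stepLaw^[i] μ : ProbabilityMeasure (Env d)) : Measure (Env d)) := by
  induction i generalizing μ with
  | zero => exact Measure.map_id
  | succ i ih =>
    rw [Function.iterate_succ, ← Measure.map_map (measurable_shift.iterate i) measurable_shift,
      map_shift_envLawFrom]
    exact ih (stepLaw μ)

theorem envLawFrom_absolutelyContinuous {d : ℕ} {μ μ' : Measure (Env d)} (h : μ ≪ μ') :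
    envLawFrom μ ≪ envLawFrom μ' := by
  refine Measure.AbsolutelyContinuous.mk fun s hs h0 => ?_
  have hm := measurable_envLaw_apply hs
  rw [envLawFrom_apply _ hs, lintegral_eq_zero_iff hm] at h0 ⊢
  exact h.ae_le h0

end RWRE

end

noncomputable section

namespace RWRE

/-! ### Invariant measures and translations -/

theorem jump_induction {d : ℕ} {p : (Fin d → ℤ) → Prop} (h0 : p 0)
    (hs : ∀ x (e : Jump d), p x → p (x + e.1)) (x : Fin d → ℤ) : p x := by
  let H : AddSubmonoid (Fin d → ℤ) :=
    { carrier := {y | ∀ x, p x → p (x + y)}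
      zero_mem' := fun x hx => by rwa [add_zero]
      add_mem' := fun {a b} ha hb x hx => by rw [← add_assoc]; exact hb _ (ha _ hx) }
  have hunit : ∀ (i : Fin d) (s : ℤ), |s| = 1 → Pi.single i s ∈ H := by
    intro i s hs1 x hx
    refine hs x ⟨Pi.single i s, ?_⟩ hx
    rw [Finset.sum_eq_single i]
    · simpa using hs1
    · intro j _ hj; simp [Pi.single_eq_of_ne hj]
    · simp
  have hsingle : ∀ (i : Fin d) (m : ℤ), (Pi.single i m : Fin d → ℤ) ∈ H := by
    intro i m
    obtain ⟨k, rfl | rfl⟩ := m.eq_nat_or_neg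
    · have := H.nsmul_mem (hunit i 1 (by simp)) k
      rwa [← Pi.single_smul', nsmul_eq_mul, mul_one] at this
    · have := H.nsmul_mem (hunit i (-1) (by simp)) k
      rwa [← Pi.single_smul', nsmul_eq_mul, mul_neg, mul_one] at this
  have hx : x ∈ H := by
    rw [← Finset.univ_sum_single x]
    exact H.sum_mem fun i _ => hsingle i (x i)
  simpa using hx 0 h0

/-- For an invariant measure of an elliptic environment, a property that holds almost surely holds
almost surely along the whole orbit under translations. -/
theorem ae_forall_translate {d : ℕ} {μ : Measure (Env d)} (hinv : μ.bind (envKernel d) = μ)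
    (hel : ∀ᵐ ω ∂μ, ∀ e : Jump d, 0 < ω 0 e) {p : Env d → Prop} (hp : ∀ᵐ ω ∂μ, p ω) :
    ∀ᵐ ω ∂μ, ∀ x, p (translate x ω) := by
  have step : ∀ {q : Env d → Prop}, (∀ᵐ ω ∂μ, q ω) → ∀ e : Jump d,
      ∀ᵐ ω ∂μ, q (translate e.1 ω) := by
    intro q hq e
    rw [← hinv] at hq
    filter_upwards [Measure.ae_ae_of_ae_comp hq, hel] with ω hω hpos
    have hω' : ∀ᵐ η ∂(∑ e : Jump d, ENNReal.ofReal (ω 0 e) • Measure.dirac (translate e.1 ω)),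
        q η := hω
    have h1 : ENNReal.ofReal (ω 0 e) • Measure.dirac (translate e.1 ω) ≤
        ∑ e : Jump d, ENNReal.ofReal (ω 0 e) • Measure.dirac (translate e.1 ω) :=
      Finset.single_le_sum (f := fun e : Jump d =>
        ENNReal.ofReal (ω 0 e) • Measure.dirac (translate e.1 ω)) (fun _ _ => Measure.zero_le _)
        (Finset.mem_univ e)
    have h2 := ae_mono h1 hω'
    rw [Measure.ae_ennreal_smul_measure_eq (ENNReal.ofReal_pos.2 (hpos e)).ne', ae_dirac_eq] at h2
    exact h2
  rw [ae_all_iff]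
  refine jump_induction ?_ fun x e hx => ?_
  · simpa only [translate_zero] using hp
  · simpa only [translate_translate] using step hx e

theorem measurableSet_forall_translate {d : ℕ} {s : Set (Env d)} (hs : MeasurableSet s) :
    MeasurableSet {ω : Env d | ∀ x, translate x ω ∈ s} := by
  have : {ω : Env d | ∀ x, translate x ω ∈ s} = ⋂ x, translate x ⁻¹' s := by
    ext; simp
  rw [this]
  exact MeasurableSet.iInter fun x => measurable_translate x hs

theorem translate_preimage_forall_translate {d : ℕ} (s : Set (Env d)) (y : Fin d → ℤ) :
    translate y ⁻¹' {ω : Env d | ∀ x, translate x ω ∈ s} = {ω | ∀ x, translate x ω ∈ s} := by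
  ext ω
  simp only [Set.mem_preimage, Set.mem_ofPred_eq, translate_translate]
  exact ⟨fun h x => by simpa using h (x - y), fun h x => h _⟩

/-- Under total ergodicity, the event that the whole orbit lies in `s` has probability
`0` or `1`. -/
theorem IsTotallyErgodic.ae_forall_translate_or {d : ℕ} {P : ProbabilityMeasure (Env d)}
    (hErg : IsTotallyErgodic P) {s : Set (Env d)} (hs : MeasurableSet s) :
    (∀ᵐ ω ∂(P : Measure (Env d)), ¬ ∀ x, translate x ω ∈ s) ∨
      ∀ᵐ ω ∂(P : Measure (Env d)), ∀ x, translate x ω ∈ s := by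
  have hm := measurableSet_forall_translate hs
  refine (hErg _ hm (translate_preimage_forall_translate s)).imp (fun h => ?_) fun h => ?_
  · rw [ae_iff]
    simpa only [not_not] using h
  · exact (prob_compl_eq_zero_iff hm).2 h

theorem absolutelyContinuous_of_invariant {d : ℕ} {P ν : ProbabilityMeasure (Env d)}
    (hE : IsElliptic P) (hErg : IsTotallyErgodic P)
    (hinv : (ν : Measure (Env d)).bind (envKernel d) = ν)
    (hac : (ν : Measure (Env d)) ≪ (P : Measure (Env d))) :
    (P : Measure (Env d)) ≪ (ν : Measure (Env d)) := by
  refine Measure.AbsolutelyContinuous.mk fun s hs h0 => ?_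
  have h1 : ∀ᵐ ω ∂(ν : Measure (Env d)), ω ∈ sᶜ := by
    rw [ae_iff]; simpa using h0
  have h2 := ae_forall_translate hinv (hac.ae_le (hE 0)) h1
  rcases hErg.ae_forall_translate_or hs.compl with h | h
  · have h3 := hac.ae_le h
    obtain ⟨ω, ha, hb⟩ := (h2.and h3).exists
    exact absurd ha hb
  · have h3 : ∀ᵐ ω ∂(P : Measure (Env d)), ω ∈ sᶜ := h.mono fun ω hω => by
      simpa only [translate_zero] using hω 0
    rw [ae_iff] at h3
    simpa using h3

theorem measurePreserving_shift {d : ℕ} {ν : Measure (Env d)}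
    (hinv : ν.bind (envKernel d) = ν) :
    MeasurePreserving shift (envLawFrom ν) (envLawFrom ν) :=
  ⟨measurable_shift, by rw [map_shift_envLawFrom, hinv]⟩

/-! ### Ergodicity of the environment viewed from the particle -/

theorem shift_iterate_preimage {d : ℕ} {A : Set (ℕ → Env d)} (hA : shift ⁻¹' A = A) (n : ℕ) :
    shift^[n] ⁻¹' A = A := by
  induction n with
  | zero => rfl
  | succ n ih => rw [Function.iterate_succ, Set.preimage_comp, ih, hA]

theorem exists_cylinder_approx {d : ℕ} (μ : Measure (ℕ → Env d)) [IsFiniteMeasure μ]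
    {A : Set (ℕ → Env d)} (hA : MeasurableSet A) {ε : ENNReal} (hε : 0 < ε) :
    ∃ (n : ℕ) (C : Set (ℕ → Env d)), MeasurableSet C ∧
      (∀ γ γ' : ℕ → Env d, (∀ i ≤ n, γ i = γ' i) → γ ∈ C → γ' ∈ C) ∧
      μ (symmDiff C A) < ε := by
  obtain ⟨C, hC, hlt⟩ := exists_measure_symmDiff_lt_of_generateFrom_isSetRing (μ := μ)
    (C := measurableCylinders fun _ : ℕ => Env d) isSetRing_measurableCylinders
    ⟨{Set.univ}, Set.countable_singleton _, by
      simpa using univ_mem_measurableCylinders fun _ : ℕ => Env d, by simp⟩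
    generateFrom_measurableCylinders.symm hA hε
  have hCm := MeasurableSet.of_mem_measurableCylinders hC
  rw [measurableCylinders_nat] at hC
  simp only [Set.mem_iUnion, Set.mem_singleton_iff] at hC
  obtain ⟨n, S, -, rfl⟩ := hC
  refine ⟨n, _, hCm, fun γ γ' h hγ => ?_, hlt⟩
  rw [mem_cylinder] at hγ ⊢
  convert hγ using 1
  exact funext fun i => (h i (Finset.mem_Iic.1 i.2)).symm

theorem setLIntegral_envLawFrom {d : ℕ} (μ : Measure (Env d)) {C : Set (ℕ → Env d)}
    (hC : MeasurableSet C) {f : (ℕ → Env d) → ENNReal} (hf : Measurable f) :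
    ∫⁻ γ in C, f γ ∂envLawFrom μ = ∫⁻ ω, ∫⁻ γ in C, f γ ∂envLaw ω ∂μ := by
  rw [← lintegral_indicator hC, lintegral_envLawFrom μ (hf.indicator hC)]
  exact lintegral_congr fun ω => lintegral_indicator hC _

/-- Zero-one law: the probability of a shift-invariant event is `0` or `1` for almost every
starting environment. -/
theorem ae_envLaw_mul_compl_eq_zero {d : ℕ} {ν : Measure (Env d)} [IsProbabilityMeasure ν]
    (hinv : ν.bind (envKernel d) = ν) {A : Set (ℕ → Env d)} (hA : MeasurableSet A)
    (hshift : shift ⁻¹' A = A) :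
    ∀ᵐ ω ∂ν, envLaw ω A * envLaw ω Aᶜ = 0 := by
  have hh := measurable_envLaw_apply hA
  have hhn : ∀ n, Measurable fun γ : ℕ → Env d => envLaw (γ n) A := fun n =>
    hh.comp (measurable_pi_apply n)
  suffices hint : ∫⁻ ω, envLaw ω A * envLaw ω Aᶜ ∂ν = 0 from
    (lintegral_eq_zero_iff (hh.mul (measurable_envLaw_apply hA.compl))).1 hint
  have hbase : ∫⁻ ω, envLaw ω A * envLaw ω Aᶜ ∂ν =
      ∫⁻ γ in Aᶜ, envLaw (γ 0) A ∂envLawFrom ν := by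
    rw [setLIntegral_envLawFrom ν hA.compl (hhn 0)]
    refine lintegral_congr fun ω => ?_
    rw [lintegral_congr_ae (g := fun _ => envLaw ω A)
      (ae_restrict_of_ae ((ae_envLaw_apply_zero ω).mono fun γ hγ => by simp only [hγ])),
      setLIntegral_const]
  have hstat : ∀ n, ∫⁻ γ in Aᶜ, envLaw (γ 0) A ∂envLawFrom ν =
      ∫⁻ γ in Aᶜ, envLaw (γ n) A ∂envLawFrom ν := by
    intro n
    have hpre : shift^[n] ⁻¹' Aᶜ = Aᶜ := by
      rw [Set.preimage_compl, shift_iterate_preimage hshift]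
    rw [← ((measurePreserving_shift hinv).iterate n).setLIntegral_comp_preimage hA.compl (hhn 0),
      hpre]
    simp only [shift_iterate_apply, zero_add]
  refine le_antisymm (ENNReal.le_of_forall_pos_le_add fun ε hε _ => ?_) zero_le
  have hε2 : (0 : ENNReal) < ε / 2 := ENNReal.half_pos (by exact_mod_cast hε.ne')
  obtain ⟨n, C, hC, hCn, hlt⟩ := exists_cylinder_approx (envLawFrom ν) hA hε2
  have hmarkov : ∫⁻ γ in Cᶜ, envLaw (γ n) A ∂envLawFrom ν = envLawFrom ν (Cᶜ ∩ A) := by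
    rw [setLIntegral_envLawFrom ν hC.compl (hhn n), envLawFrom_apply _ (hC.compl.inter hA)]
    refine lintegral_congr fun ω => ?_
    rw [← envLaw_inter_shift_preimage hA n hC.compl (fun γ γ' h hγ hγ' =>
      hγ (hCn γ' γ (fun i hi => (h i hi).symm) hγ')), shift_iterate_preimage hshift]
  rw [zero_add, hbase, hstat n]
  calc ∫⁻ γ in Aᶜ, envLaw (γ n) A ∂envLawFrom ν
      ≤ ∫⁻ γ in Cᶜ ∪ C \ A, envLaw (γ n) A ∂envLawFrom ν :=
        lintegral_mono_set fun γ hγ => by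
          by_cases h : γ ∈ C
          · exact Or.inr ⟨h, hγ⟩
          · exact Or.inl h
    _ ≤ ∫⁻ γ in Cᶜ, envLaw (γ n) A ∂envLawFrom ν + ∫⁻ γ in C \ A, envLaw (γ n) A ∂envLawFrom ν :=
        lintegral_union_le _ _ _
    _ ≤ envLawFrom ν (Cᶜ ∩ A) + ∫⁻ γ in C \ A, 1 ∂envLawFrom ν := by
        rw [hmarkov]
        gcongr
        exact prob_le_one
    _ ≤ ε / 2 + ε / 2 := by
        rw [setLIntegral_one]
        refine add_le_add ((measure_mono ?_).trans hlt.le) ((measure_mono ?_).trans hlt.le)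
        · exact fun γ hγ => Or.inr ⟨hγ.2, hγ.1⟩
        · exact fun γ hγ => Or.inl hγ
    _ = ε := ENNReal.add_halves _

theorem ergodic_shift {d : ℕ} {P ν : ProbabilityMeasure (Env d)}
    (hE : IsElliptic P) (hErg : IsTotallyErgodic P)
    (hinv : (ν : Measure (Env d)).bind (envKernel d) = ν)
    (hac : (ν : Measure (Env d)) ≪ (P : Measure (Env d))) :
    Ergodic shift (envLawFrom (ν : Measure (Env d))) := by
  refine ⟨measurePreserving_shift hinv, ⟨fun A hA hshift => ?_⟩⟩
  have hel := hac.ae_le (hE 0)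
  have hs : MeasurableSet {ω : Env d | envLaw ω A = 0} :=
    measurable_envLaw_apply hA (measurableSet_singleton 0)
  have horbit : ∀ᵐ ω ∂(ν : Measure (Env d)), envLaw ω A = 0 →
      ∀ x, translate x ω ∈ {ω : Env d | envLaw ω A = 0} := by
    filter_upwards [ae_forall_translate hinv hel hel] with ω hω h0
    refine jump_induction (by simpa only [translate_zero] using h0) fun x e hx => ?_
    have h1 : envLaw (translate x ω) A = 0 := hx
    rw [← hshift, envLaw_shift_preimage _ hA, Finset.sum_eq_zero_iff] at h1
    have h2 := (mul_eq_zero.1 (h1 e (Finset.mem_univ e))).resolve_left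
      (ENNReal.ofReal_pos.2 (hω x e)).ne'
    rwa [translate_translate, add_comm] at h2
  rw [eventuallyConst_set]
  rcases hErg.ae_forall_translate_or hs with h | h
  · left
    have h0 : envLawFrom (ν : Measure (Env d)) Aᶜ = 0 := by
      rw [envLawFrom_apply _ hA.compl, lintegral_eq_zero_iff (measurable_envLaw_apply hA.compl)]
      filter_upwards [hac.ae_le h, horbit, ae_envLaw_mul_compl_eq_zero hinv hA hshift]
        with ω h1 h2 h3
      exact (mul_eq_zero.1 h3).resolve_left fun h4 => h1 (h2 h4)
    exact h0
  · right
    have h0 : envLawFrom (ν : Measure (Env d)) A = 0 := by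
      rw [envLawFrom_apply _ hA, lintegral_eq_zero_iff (measurable_envLaw_apply hA)]
      filter_upwards [hac.ae_le h] with ω h1
      simpa only [translate_zero, Pi.zero_apply] using! h1 0
    exact measure_eq_zero_iff_ae_notMem.1 h0

theorem invariant_unique {d : ℕ} {ν ν' : Measure (Env d)} [IsProbabilityMeasure ν]
    [IsProbabilityMeasure ν'] (hν : Ergodic shift (envLawFrom ν))
    (hinv : ν'.bind (envKernel d) = ν') (hac : ν' ≪ ν) : ν' = ν := by
  have h := hν.eq_of_absolutelyContinuous (measurePreserving_shift hinv)
    (envLawFrom_absolutelyContinuous hac)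
  rw [← map_eval_zero_envLawFrom ν', h, map_eval_zero_envLawFrom]

/-! ### Convergence of the Cesàro means -/

theorem integral_cesaroMean {d : ℕ} (μ : ProbabilityMeasure (Env d)) (n : ℕ)
    (f : BoundedContinuousFunction (Env d) ℝ) :
    ∫ ω, f ω ∂(cesaroMean μ n : Measure (Env d)) = ((n + 1 : ℕ) : ℝ)⁻¹ *
      ∑ i ∈ Finset.range (n + 1),
        ∫ γ, f (shift^[i] γ 0) ∂envLawFrom (μ : Measure (Env d)) := by
  have hf : Measurable f := f.continuous.measurable
  have hc : (cesaroMean μ n : Measure (Env d)) = ((n : ENNReal) + 1)⁻¹ •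
      ∑ i ∈ Finset.range (n + 1),
        ((stepLaw^[i] μ : ProbabilityMeasure (Env d)) : Measure (Env d)) := rfl
  rw [hc, integral_smul_measure, integral_finsetSum_measure fun i _ => f.integrable _, smul_eq_mul]
  congr 1
  · rw [ENNReal.toReal_inv, ENNReal.toReal_add (by simp) (by simp)]
    simp
  · refine Finset.sum_congr rfl fun i _ => ?_
    have h0 : Measurable fun γ : ℕ → Env d => γ 0 := measurable_pi_apply 0
    rw [← integral_map (μ := envLawFrom (μ : Measure (Env d))) (φ := shift^[i])
        (f := fun γ => f (γ 0)) (measurable_shift.iterate i).aemeasurable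
        (hf.comp h0).aestronglyMeasurable, map_shift_iterate_envLawFrom,
      ← integral_map (f := f) h0.aemeasurable hf.aestronglyMeasurable, map_eval_zero_envLawFrom]

theorem tendsto_cesaroMean {d : ℕ} {P ν : ProbabilityMeasure (Env d)}
    (hν : Ergodic shift (envLawFrom (ν : Measure (Env d))))
    (hac : (P : Measure (Env d)) ≪ (ν : Measure (Env d))) :
    Tendsto (fun n : ℕ => cesaroMean P n) atTop (𝓝 ν) := by
  rw [ProbabilityMeasure.tendsto_iff_forall_integral_tendsto]
  intro f
  have h0 : Measurable fun γ : ℕ → Env d => γ 0 := measurable_pi_apply 0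
  have hf : Measurable f := f.continuous.measurable
  have h := hν.tendsto_average_integral (envLawFrom_absolutelyContinuous hac) (hf.comp h0)
    fun γ => f.norm_coe_le_norm (γ 0)
  have hlim : ∫ γ, (f ∘ fun γ : ℕ → Env d => γ 0) γ ∂envLawFrom (ν : Measure (Env d)) =
      ∫ ω, f ω ∂(ν : Measure (Env d)) := by
    conv_rhs => rw [← map_eval_zero_envLawFrom (ν : Measure (Env d)),
      integral_map h0.aemeasurable hf.aestronglyMeasurable]
    rfl
  rw [hlim] at h
  simp only [integral_cesaroMean]
  exact h.comp (tendsto_add_atTop_nat 1)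

end RWRE

end
theorem mainTheorem1 (d : ℕ) (P ν : ProbabilityMeasure (RWRE.Env d))
    (hE : RWRE.IsElliptic P) (hErg : RWRE.IsTotallyErgodic P)
    (hinv : RWRE.IsInvariant ν) (hac : (ν : Measure (RWRE.Env d)) ≪ (P : Measure (RWRE.Env d))) :
    -- `ν` and `P` are equivalent
    ((ν : Measure (RWRE.Env d)) ≪ (P : Measure (RWRE.Env d)) ∧
      (P : Measure (RWRE.Env d)) ≪ (ν : Measure (RWRE.Env d))) ∧
    -- the environmental process with initial law `ν` is ergodic
    Ergodic RWRE.shift (RWRE.envLawFrom (ν : Measure (RWRE.Env d))) ∧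
    -- uniqueness
    (∀ ν' : ProbabilityMeasure (RWRE.Env d), RWRE.IsInvariant ν' →
      (ν' : Measure (RWRE.Env d)) ≪ (P : Measure (RWRE.Env d)) → ν' = ν) ∧
    -- weak convergence of the Cesàro means
    Tendsto (fun n : ℕ => RWRE.cesaroMean P n) atTop (𝓝 ν) := by
  have hinv' : ∀ μ : ProbabilityMeasure (RWRE.Env d), RWRE.IsInvariant μ →
      (μ : Measure (RWRE.Env d)).bind (RWRE.envKernel d) = μ := fun μ h => congrArg Subtype.val h
  have hPν := RWRE.absolutelyContinuous_of_invariant hE hErg (hinv' ν hinv) hac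
  have herg := RWRE.ergodic_shift hE hErg (hinv' ν hinv) hac
  exact ⟨⟨hac, hPν⟩, herg, fun ν' hν' hac' =>
    Subtype.ext (RWRE.invariant_unique (ν := (ν : Measure (RWRE.Env d)))
      (ν' := (ν' : Measure (RWRE.Env d))) herg (hinv' ν' hν') (hac'.trans hPν)),
    RWRE.tendsto_cesaroMean herg hPν⟩
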